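/- Let $G$ be a finite simple graph (no loops, no multiple edges) with vertex set $V=\{x_1,\dots,x_n\}$, let $K$ be a field, and let $S=K[x_1,\dots,x_n]$. A vertex cover of $G$ is a set $w\subseteq V$ that meets every edge of $G$, and the cover ideal of $G$ is $$J=\Big(\prod_{x_i\in w}x_i \;:\; w \text{ is a vertex cover of } G\Big)\subseteq S.$$ Write $\operatorname{Ass}(S/I)$ for the set of associated primes of the $S$-module $S/I$, $\chi$ for the chromatic number and $\omega$ for the clique number (the largest number of vertices of a complete subgraph). The graph $G$ is perfect if $\chi(H)=\omega(H)$ for every induced subgraph $H$ of $G$. An ideal $I\subseteq S$ has the saturated chain property for associated primes if for every $P\in\operatorname{Ass}(S/I)$ that is not a minimal prime of $I$ there is a $Q\in\operatorname{Ass}(S/I)$ with $Q\subsetneq P$ and $\operatorname{height}(Q)=\operatorname{height}(P)-1$. Theorem. The following are equivalent: 1. $G$ is perfect. 2. For every integer $s$ with $1\le s<\chi(G)$, $$\operatorname{Ass}(S/J^s)=\big\{(x_{i_1},\dots,x_{i_r}) \;:\; \{x_{i_1},\dots,x_{i_r}\} \text{ is a clique of } G \text{ with } r \text{ vertices},\ 1<r\le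 s+1\big\}.$$ 3. For every integer $s\ge 1$, the power $J^s$ has the saturated chain property for associated primes. -/

import Mathlib

/-- A finite simple graph `G` is perfect if every induced subgraph `H` of `G` satisfies
`χ(H) = ω(H)`. -/
def IsPerfectGraph {V : Type*} (G : SimpleGraph V) : Prop :=
  ∀ W : Set V, (G.induce W).chromaticNumber = ((G.induce W).cliqueNum : ℕ∞)

/-- The cover ideal of a finite simple graph `G`: the ideal of the polynomial ring `K[V]` generated
by the squarefree monomials `∏ v ∈ w, x_v`, where `w` runs over the vertex covers of `G`. -/
noncomputable def coverIdeal (K : Type*) [Field K] {V : Type*} (G : SimpleGraph V) :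
    Ideal (MvPolynomial V K) :=
  Ideal.span {m | ∃ w : Finset V, G.IsVertexCover (w : Set V) ∧
    m = ∏ v ∈ w, (MvPolynomial.X v : MvPolynomial V K)}

/-- The monomial ideal `(x_v : v ∈ T)` generated by the variables in `T`. -/
noncomputable def variableIdeal (K : Type*) [Field K] {V : Type*} (T : Finset V) :
    Ideal (MvPolynomial V K) :=
  Ideal.span ((MvPolynomial.X : V → MvPolynomial V K) '' (T : Set V))

/-- An ideal `I` of a Noetherian ring `R` has the saturated chain property for associated primes if
every associated prime `P` of `R ⧸ I` that is not a minimal prime of `I` strictly contains an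
associated prime `Q` of `R ⧸ I` with `height Q = height P - 1`. -/
def HasSaturatedChainProperty {R : Type*} [CommRing R] (I : Ideal R) : Prop :=
  ∀ P ∈ associatedPrimes R (R ⧸ I), P ∉ I.minimalPrimes →
    ∃ Q ∈ associatedPrimes R (R ⧸ I), Q < P ∧ Q.height + 1 = P.height

/-! Complements of vertex covers are independent sets, so `x^a` lies in `J^s` exactly when `s`
colours suffice to give each vertex `v` at least `s - a v` colours, disjointly along edges
(`monomial_mem_coverIdeal_pow_iff`). Associated primes of a monomial ideal have the form `I : x^a`
and are generated by variables; hence the prime of `T` is associated to `J^s` iff `T` supports a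
critical weight: not multicolourable, but multicolourable once any value on `T` drops by one.

If every induced subgraph of `G[T]` satisfies `χ = ω`, Lovász replication makes clique weights the
only obstruction. A critical weight is then supported on a clique, with total `s + 1` and values
between `1` and `s`, and every clique with 2 to `s + 1` vertices carries one. This gives 2, and 3
follows by deleting a vertex from a clique.

If `G` is imperfect, take a minimal imperfect `G[W]` and `s ≥ ω(G[W])` colours that do not suffice
for it. The indicator of `W` is critical, yet `W` is no clique, against 2. Against 3, a predecessor
`T = W \ {v}` would be a clique with at most `s` vertices, and `v` could reuse the colour of a
non-neighbour in `T`. -/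

namespace SimpleGraph

/-! ### Multicolourings and the replication lemma. -/

variable {V : Type*}

/-- `G` admits a multicolouring with `s` colours that assigns to every vertex `v` a set of at least
`b v` colours, adjacent vertices receiving disjoint sets. -/
def Multicolorable (G : SimpleGraph V) (s : ℕ) (b : V → ℕ) : Prop :=
  ∃ f : V → Finset (Fin s), (∀ v, b v ≤ (f v).card) ∧ ∀ u v, G.Adj u v → Disjoint (f u) (f v)

variable {G : SimpleGraph V}

theorem Multicolorable.mono {s : ℕ} {b c : V → ℕ} (h : G.Multicolorable s b) (hcb : ∀ v, c v ≤ b v) :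
    G.Multicolorable s c :=
  let ⟨f, hf, hd⟩ := h
  ⟨f, fun v => (hcb v).trans (hf v), hd⟩

theorem Multicolorable.exists_card_eq {s : ℕ} {b : V → ℕ} (h : G.Multicolorable s b) :
    ∃ f : V → Finset (Fin s), (∀ v, (f v).card = b v) ∧ ∀ u v, G.Adj u v → Disjoint (f u) (f v) := by
  obtain ⟨f, hf, hd⟩ := h
  choose g hg hc using fun v => Finset.exists_subset_card_eq (hf v)
  exact ⟨g, hc, fun u v huv => (hd u v huv).mono (hg u) (hg v)⟩

theorem card_biUnion_of_isClique [DecidableEq V] {s : ℕ} {b : V → ℕ}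
    {f : V → Finset (Fin s)} (hf : ∀ v, (f v).card = b v)
    (hd : ∀ u v, G.Adj u v → Disjoint (f u) (f v)) {T : Finset V} (hT : G.IsClique (T : Set V)) :
    (T.biUnion f).card = ∑ v ∈ T, b v := by
  rw [Finset.card_biUnion fun u hu v hv huv => hd u v (hT hu hv huv)]
  exact Finset.sum_congr rfl fun v _ => hf v

theorem Multicolorable.sum_le_of_isClique {s : ℕ} {b : V → ℕ} (h : G.Multicolorable s b)
    {T : Finset V} (hT : G.IsClique (T : Set V)) : ∑ v ∈ T, b v ≤ s := by
  classical
  obtain ⟨f, hf, hd⟩ := h.exists_card_eq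
  rw [← card_biUnion_of_isClique hf hd hT]
  exact (Finset.card_le_univ _).trans_eq (Fintype.card_fin s)

/-- A multicolouring with `s` colours together with one further independent set. -/
theorem Multicolorable.succ {s : ℕ} {b c : V → ℕ} (h : G.Multicolorable s b) (A : Set V)
    (hA : G.IsIndepSet A) (hc : ∀ v ∈ A, c v ≤ b v + 1) (hc' : ∀ v ∉ A, c v ≤ b v) :
    G.Multicolorable (s + 1) c := by
  classical
  obtain ⟨f, hf, hd⟩ := h
  have hlast : ∀ v, Fin.last s ∉ (f v).map Fin.castSuccEmb := fun v hv => by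
    obtain ⟨i, -, hi⟩ := Finset.mem_map.1 hv
    exact (Fin.castSucc_lt_last i).ne hi
  refine ⟨fun v => if v ∈ A then insert (Fin.last s) ((f v).map Fin.castSuccEmb)
    else (f v).map Fin.castSuccEmb, fun v => ?_, fun u v huv => ?_⟩
  · have := hf v
    dsimp only
    split_ifs with hv
    · rw [Finset.card_insert_of_notMem (hlast v), Finset.card_map]
      exact (hc v hv).trans (by omega)
    · rw [Finset.card_map]
      exact (hc' v hv).trans this
  · have hm : Disjoint ((f u).map Fin.castSuccEmb) ((f v).map Fin.castSuccEmb) :=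
      (Finset.disjoint_map _).2 (hd u v huv)
    dsimp only
    split_ifs with hu hv hv
    · exact absurd huv (hA hu hv huv.ne)
    · exact Finset.disjoint_insert_left.2 ⟨hlast v, hm⟩
    · exact Finset.disjoint_insert_right.2 ⟨hlast u, hm⟩
    · exact hm

theorem multicolorable_of_colorable_induce {s : ℕ} {b : V → ℕ} {U : Set V}
    (h : (G.induce U).Colorable s) (hb : ∀ v, b v ≤ 1) (hU : ∀ v, b v ≠ 0 → v ∈ U) :
    G.Multicolorable s b := by
  classical
  obtain ⟨C⟩ := h
  refine ⟨fun v => if hv : v ∈ U then {C ⟨v, hv⟩} else ∅, fun v => ?_, fun u v huv => ?_⟩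
  · dsimp only
    split_ifs with hv
    · simpa using hb v
    · simpa using not_imp_comm.1 (hU v) hv
  · dsimp only
    split_ifs with hu hv hv
    · rw [Finset.disjoint_singleton]
      exact C.valid (v := ⟨u, hu⟩) (w := ⟨v, hv⟩) huv
    all_goals simp

theorem Multicolorable.colorable_induce {s : ℕ} {b : V → ℕ} (h : G.Multicolorable s b) {U : Set V}
    (hU : ∀ v ∈ U, b v ≠ 0) : (G.induce U).Colorable s := by
  obtain ⟨f, hf, hd⟩ := h
  have hne : ∀ v : U, (f v).Nonempty := fun v =>
    Finset.card_pos.1 ((Nat.pos_of_ne_zero (hU v v.2)).trans_le (hf v))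
  choose c hc using hne
  exact ⟨Coloring.mk c fun {u v} huv he =>
    Finset.disjoint_left.1 (hd u v huv) (hc u) (he ▸ hc v)⟩

/-- Lovász's replication lemma, in terms of multicolourings: if every induced subgraph of `G[W]` can
be coloured with as many colours as its clique number, then a weight function supported on `W` has a
multicolouring with `s` colours as soon as every clique has weight at most `s`. -/
theorem multicolorable_of_sum_isClique_le [Fintype V] {W : Set V}
    (hW : ∀ U ⊆ W, ∀ s, (∀ T : Finset V, G.IsClique (T : Set V) → (T : Set V) ⊆ U → T.card ≤ s) →
      (G.induce U).Colorable s) {s : ℕ} {b : V → ℕ} (hbW : ∀ v, b v ≠ 0 → v ∈ W)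
    (hb : ∀ T : Finset V, G.IsClique (T : Set V) → ∑ v ∈ T, b v ≤ s) :
    G.Multicolorable s b := by
  classical
  induction hn : ∑ v, b v using Nat.strong_induction_on generalizing s b with
  | _ n ih =>
  subst hn
  by_cases h1 : ∀ v, b v ≤ 1
  · refine multicolorable_of_colorable_induce (hW {v | b v ≠ 0} hbW s fun T hT hTU => ?_) h1
      fun v hv => hv
    rw [Finset.card_eq_sum_ones]
    exact (Finset.sum_le_sum fun v hv => Nat.one_le_iff_ne_zero.2 (hTU hv)).trans (hb T hT)
  push Not at h1
  obtain ⟨v, hv⟩ := h1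
  -- Since `b v ≥ 2`, the lowered weight is still positive at `v`. Its multicolouring `g` uses some
  -- colour `c` there; the class of `c` is the independent set to split off.
  set b' := Function.update b v (b v - 1) with hb'
  have hb'v : b' v = b v - 1 := Function.update_self ..
  have hb'u : ∀ u, u ≠ v → b' u = b u := fun u hu => Function.update_of_ne hu ..
  have hb'le : ∀ u, b' u ≤ b u := fun u => by
    by_cases hu : u = v
    · subst hu; omega
    · exact (hb'u u hu).le
  obtain ⟨g, hg, hgd⟩ := (ih (∑ u, b' u)
    (Finset.sum_lt_sum (fun u _ => hb'le u) ⟨v, Finset.mem_univ v, by omega⟩)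
    (fun u hu => hbW u fun h => hu (Nat.le_zero.1 (h ▸ hb'le u)))
    (fun T hT => (Finset.sum_le_sum fun u _ => hb'le u).trans (hb T hT)) rfl).exists_card_eq
  obtain ⟨c, hc⟩ : (g v).Nonempty := Finset.card_pos.1 (by rw [hg]; omega)
  obtain ⟨t, rfl⟩ : ∃ t, s = t + 1 := ⟨s - 1, by have := c.2; omega⟩
  have hpos : ∀ u, c ∈ g u → 1 ≤ b u := fun u hu =>
    (Finset.card_pos.2 ⟨c, hu⟩).trans_le ((hg u).trans_le (hb'le u))
  set b'' : V → ℕ := fun u => if c ∈ g u then b u - 1 else b u with hb''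
  have hb''le : ∀ u, b'' u ≤ b u := fun u => by
    simp only [hb'']; split_ifs <;> omega
  have hb''lt : ∀ u, c ∈ g u → b'' u < b u := fun u hu => by
    have := hpos u hu
    simp only [hb'', if_pos hu]; omega
  have hlt : ∑ u, b'' u < ∑ u, b u :=
    Finset.sum_lt_sum (fun u _ => hb''le u) ⟨v, Finset.mem_univ v, hb''lt v hc⟩
  refine Multicolorable.succ (b := b'') (ih _ hlt
    (fun u hu => hbW u fun h => hu (Nat.le_zero.1 (h ▸ hb''le u))) (fun T hT => ?_) rfl)
    {u | c ∈ g u} (fun x hx y hy _ hxy => Finset.disjoint_left.1 (hgd x y hxy) hx hy)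
    (fun u hu => by
      have : c ∈ g u := hu
      simp only [hb'', if_pos this]; omega)
    (fun u hu => by
      have : c ∉ g u := hu
      simp only [hb'', if_neg this]; omega)
  -- A clique meeting the class of `c` loses weight. One missing it avoids `v`, so `b''` agrees with
  -- `b'` on it and `g` colours it without `c`, using at most `t` colours.
  by_cases hTc : ∃ u ∈ T, c ∈ g u
  · obtain ⟨u, huT, hu⟩ := hTc
    have := Finset.sum_lt_sum (fun u _ => hb''le u) ⟨u, huT, hb''lt u hu⟩
    have := hb T hT
    omega
  · push Not at hTc
    have heq : ∑ u ∈ T, b'' u = ∑ u ∈ T, b' u := Finset.sum_congr rfl fun u hu => by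
      rw [hb'u u (by rintro rfl; exact hTc _ hu hc)]
      simp only [hb'', if_neg (hTc u hu)]
    rw [heq, ← card_biUnion_of_isClique hg hgd hT]
    have hsub : T.biUnion g ⊆ Finset.univ.erase c := fun i hi => by
      obtain ⟨u, hu, hiu⟩ := Finset.mem_biUnion.1 hi
      exact Finset.mem_erase.2 ⟨fun h => hTc u hu (h ▸ hiu), Finset.mem_univ _⟩
    simpa using Finset.card_le_card hsub

end SimpleGraph

open MvPolynomial

/-! ### Primes generated by variables. -/

section VariableIdeal

variable {V K : Type*} [Field K]

theorem mem_variableIdeal {T : Finset V} {x : MvPolynomial V K} :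
    x ∈ variableIdeal K T ↔ ∀ m ∈ x.support, ∃ v ∈ T, m v ≠ 0 :=
  mem_ideal_span_X_image

theorem X_mem_variableIdeal {T : Finset V} {v : V} :
    (X v : MvPolynomial V K) ∈ variableIdeal K T ↔ v ∈ T := by
  classical
  rw [mem_variableIdeal, support_X]
  simp [Finsupp.single_apply]

theorem monomial_mem_variableIdeal {T : Finset V} {a : V →₀ ℕ} :
    monomial a (1 : K) ∈ variableIdeal K T ↔ ∃ v ∈ T, a v ≠ 0 := by
  classical
  rw [mem_variableIdeal, support_monomial, if_neg one_ne_zero]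
  simp

theorem variableIdeal_le_iff {T : Finset V} {I : Ideal (MvPolynomial V K)} :
    variableIdeal K T ≤ I ↔ ∀ v ∈ T, X v ∈ I := by
  rw [variableIdeal, Ideal.span_le, Set.image_subset_iff]
  rfl

theorem variableIdeal_le_variableIdeal_iff {S T : Finset V} :
    variableIdeal K S ≤ variableIdeal K T ↔ S ⊆ T := by
  simp only [variableIdeal_le_iff, X_mem_variableIdeal, Finset.subset_iff]

theorem variableIdeal_lt_variableIdeal_iff {S T : Finset V} :
    variableIdeal K S < variableIdeal K T ↔ S ⊂ T := by
  rw [lt_iff_le_not_ge, variableIdeal_le_variableIdeal_iff, variableIdeal_le_variableIdeal_iff]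
  rfl

theorem variableIdeal_injective : Function.Injective (variableIdeal K (V := V)) := fun _ _ h =>
  (variableIdeal_le_variableIdeal_iff.1 h.le).antisymm (variableIdeal_le_variableIdeal_iff.1 h.ge)

/-- The ideal is the kernel of the substitution sending the variables of `T` to zero, a map into a
domain. -/
instance variableIdeal_isPrime (T : Finset V) : (variableIdeal K T).IsPrime := by
  classical
  let φ : MvPolynomial V K →ₐ[K] MvPolynomial V K := aeval fun v => if v ∈ T then 0 else X v
  have hφ : ∀ x, x - φ x ∈ variableIdeal K T := fun x => by
    induction x using MvPolynomial.induction_on with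
    | C a => simp [φ]
    | add p q hp hq =>
      rw [map_add, add_sub_add_comm]
      exact add_mem hp hq
    | mul_X p v hp =>
      have hv : X v - φ (X v) ∈ variableIdeal K T := by
        by_cases h : v ∈ T <;> simp [φ, h, X_mem_variableIdeal]
      rw [map_mul, show p * X v - φ p * φ (X v) = (p - φ p) * X v + φ p * (X v - φ (X v)) by ring]
      exact add_mem (Ideal.mul_mem_right _ _ hp) (Ideal.mul_mem_left _ _ hv)
  have : variableIdeal K T = RingHom.ker φ := by
    refine le_antisymm (variableIdeal_le_iff.2 fun v hv => by simp [φ, hv]) fun x hx => ?_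
    simpa [RingHom.mem_ker.1 hx] using hφ x
  rw [this]
  exact RingHom.ker_isPrime _

/-- Krull's height theorem gives the upper bound; adjoining variables one at a time gives a chain of
primes for the lower one. -/
theorem height_variableIdeal [Finite V] (T : Finset V) : (variableIdeal K T).height = T.card := by
  classical
  refine le_antisymm ?_ ?_
  · refine (Ideal.height_le_card_of_mem_minimalPrimes_span (s := X '' (T : Set V))
      (T.finite_toSet.image _) ?_).trans ?_
    · change variableIdeal K T ∈ (variableIdeal K T).minimalPrimes
      rw [Ideal.minimalPrimes_eq_subsingleton_self]
      rfl
    · rw [← Set.ncard_coe_finset T, Nat.cast_le]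
      exact Set.ncard_image_le T.finite_toSet
  · induction T using Finset.induction_on with
    | empty => simp
    | insert v T hv ih =>
      rw [Finset.card_insert_of_notMem hv, Nat.cast_add, Nat.cast_one]
      exact (add_le_add_left ih 1).trans (Ideal.height_add_one_le_of_lt_of_isPrime
        (variableIdeal_lt_variableIdeal_iff.2 (Finset.ssubset_insert hv)))

end VariableIdeal

/-! ### Associated primes of monomial ideals. -/

section MonomialIdeal

variable {V K : Type*} [Field K]

theorem mem_associatedPrimes_quotient_iff {R : Type*} [CommRing R] [IsNoetherianRing R]
    {I P : Ideal R} :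
    P ∈ associatedPrimes R (R ⧸ I) ↔ P.IsPrime ∧ ∃ f, ∀ g, g ∈ P ↔ g * f ∈ I := by
  rw [AssociatedPrimes.mem_iff, isAssociatedPrime_iff]
  refine and_congr_right fun _ => ⟨?_, ?_⟩
  · rintro ⟨x, rfl⟩
    obtain ⟨f, rfl⟩ := Ideal.Quotient.mk_surjective x
    refine ⟨f, fun g => ?_⟩
    rw [Submodule.mem_colon_singleton, Submodule.mem_bot, ← Ideal.Quotient.eq_zero_iff_mem]
    rfl
  · rintro ⟨f, hf⟩
    refine ⟨Ideal.Quotient.mk I f, Ideal.ext fun g => ?_⟩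
    rw [hf, Submodule.mem_colon_singleton, Submodule.mem_bot, ← Ideal.Quotient.eq_zero_iff_mem]
    rfl

theorem le_of_mem_associatedPrimes_quotient {R : Type*} [CommRing R] [IsNoetherianRing R]
    {I P : Ideal R} (h : P ∈ associatedPrimes R (R ⧸ I)) : I ≤ P := by
  obtain ⟨-, f, hf⟩ := mem_associatedPrimes_quotient_iff.1 h
  exact fun g hg => (hf g).2 (I.mul_mem_right f hg)

theorem monomial_mem_span_monomial_iff {N : Set (V →₀ ℕ)} {a : V →₀ ℕ} :
    monomial a (1 : K) ∈ Ideal.span ((fun a => monomial a (1 : K)) '' N) ↔ ∃ n ∈ N, n ≤ a := by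
  classical
  rw [mem_ideal_span_monomial_image, support_monomial, if_neg one_ne_zero]
  simp

theorem mem_span_monomial_iff {N : Set (V →₀ ℕ)} {f : MvPolynomial V K} :
    f ∈ Ideal.span ((fun a => monomial a (1 : K)) '' N) ↔
      ∀ a ∈ f.support, monomial a (1 : K) ∈ Ideal.span ((fun a => monomial a (1 : K)) '' N) := by
  simp only [monomial_mem_span_monomial_iff]
  exact mem_ideal_span_monomial_image

theorem support_sub_monomial_coeff [DecidableEq V] (f : MvPolynomial V K) (a : V →₀ ℕ) :
    (f - monomial a (f.coeff a)).support = f.support.erase a := by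
  ext b
  rw [Finset.mem_erase, mem_support_iff, mem_support_iff, coeff_sub, coeff_monomial]
  by_cases h : a = b
  · simp [h]
  · simp [h, Ne.symm h]

theorem support_monomial_one_mul [DecidableEq V] (f : MvPolynomial V K) (a : V →₀ ℕ) :
    (monomial a 1 * f).support = f.support.map (addLeftEmbedding a) := by
  ext b
  rw [mem_support_iff, coeff_monomial_mul', Finset.mem_map]
  constructor
  · intro h
    split_ifs at h with hab
    · exact ⟨b - a, by simpa using h, add_tsub_cancel_of_le hab⟩
    · exact absurd rfl h
  · rintro ⟨c, hc, rfl⟩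
    simpa using hc

variable {N : Set (V →₀ ℕ)} {I : Ideal (MvPolynomial V K)}

/-- If `P` annihilates `f` modulo a monomial ideal, and `f` has as few terms as possible, then `P`
contains the leading monomials of its elements. -/
theorem monomial_degree_mem_of_minimal_support (hI : I = Ideal.span ((fun a => monomial a 1) '' N))
    (m : MonomialOrder V) {P : Ideal (MvPolynomial V K)} [P.IsPrime] {f : MvPolynomial V K}
    (hf : ∀ g, g ∈ P ↔ g * f ∈ I)
    (hmin : ∀ f' : MvPolynomial V K, (∀ g, g ∈ P ↔ g * f' ∈ I) →
      f.support.card ≤ f'.support.card)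
    {g : MvPolynomial V K} (hg : g ∈ P) (hg0 : g ≠ 0) : monomial (m.degree g) 1 ∈ P := by
  classical
  by_contra hd
  have hf0 : f ≠ 0 := by
    rintro rfl
    exact hd ((hf _).2 (by simp))
  have hlead : monomial (m.degree g + m.degree f) (1 : K) ∈ I := by
    have := (hf g).1 hg
    rw [hI, mem_span_monomial_iff] at this
    rw [← m.degree_mul hg0 hf0, hI]
    exact this _ (m.degree_mem_support (mul_ne_zero hg0 hf0))
  -- The product of the leading terms lies in `I`, so `f'` is congruent to `x^(deg g) * f` modulo
  -- `I`. As `x^(deg g) ∉ P` and `P` is prime, `f'` has the same annihilator `P` with one term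
  -- fewer.
  set f' := monomial (m.degree g) 1 * (f - monomial (m.degree f) (f.coeff (m.degree f))) with hf'
  have hff' : monomial (m.degree g) 1 * f - f' ∈ I := by
    have : monomial (m.degree g) 1 * f - f' =
        C (f.coeff (m.degree f)) * monomial (m.degree g + m.degree f) (1 : K) := by
      rw [hf', mul_sub, sub_sub_cancel, monomial_mul, C_mul_monomial, one_mul, mul_one]
    rw [this]
    exact I.mul_mem_left _ hlead
  have hcard : f'.support.card < f.support.card := by
    rw [hf', support_monomial_one_mul, Finset.card_map, support_sub_monomial_coeff]
    exact Finset.card_erase_lt_of_mem (m.degree_mem_support hf0)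
  refine hcard.not_ge (hmin f' fun h => ?_)
  have h1 : h * (monomial (m.degree g) 1 * f) - h * f' ∈ I := by
    rw [← mul_sub]
    exact I.mul_mem_left _ hff'
  have h2 : h * f' ∈ I ↔ h * monomial (m.degree g) 1 * f ∈ I := by
    rw [mul_assoc]
    exact ⟨fun h' => by simpa using add_mem h1 h', fun h' => by simpa using sub_mem h' h1⟩
  rw [h2, ← hf]
  exact ⟨fun h' => P.mul_mem_right _ h', fun h' => (Ideal.IsPrime.mem_or_mem ‹_› h').resolve_right hd⟩

/-- Leading terms can be stripped off without leaving `P`, so all monomials of `g` lie in `P`;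
primality then extracts a variable from each. -/
theorem exists_mem_support_of_mem_of_minimal_support
    {P : Ideal (MvPolynomial V K)} [P.IsPrime] (m : MonomialOrder V)
    (hP : ∀ g ∈ P, g ≠ 0 → monomial (m.degree g) 1 ∈ P)
    {g : MvPolynomial V K} (hg : g ∈ P) : ∀ a ∈ g.support, ∃ v, X v ∈ P ∧ a v ≠ 0 := by
  classical
  induction hn : g.support.card using Nat.strong_induction_on generalizing g with
  | _ n ih =>
  subst hn
  intro a ha
  have hg0 : g ≠ 0 := by
    rintro rfl
    simp at ha
  have hd := hP g hg hg0
  by_cases had : a = m.degree g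
  · rw [← had, monomial_eq, C_1, one_mul, Finsupp.prod, Ideal.IsPrime.prod_mem_iff] at hd
    obtain ⟨v, hv, hvP⟩ := hd
    exact ⟨v, Ideal.IsPrime.mem_of_pow_mem ‹_› _ hvP, Finsupp.mem_support_iff.1 hv⟩
  · have hs := support_sub_monomial_coeff g (m.degree g)
    refine ih _ ?_ (g := g - monomial (m.degree g) (g.coeff (m.degree g))) ?_ rfl a ?_
    · rw [hs]
      exact Finset.card_erase_lt_of_mem (m.degree_mem_support hg0)
    · refine sub_mem hg ?_
      rw [← mul_one (g.coeff _), ← C_mul_monomial]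
      exact P.mul_mem_left _ hd
    · rw [hs]
      exact Finset.mem_erase.2 ⟨had, ha⟩

/-- The associated primes of a monomial ideal `I` are the ideals generated by variables which have
the form `I : x^a` for a monomial `x^a`. -/
theorem mem_associatedPrimes_monomialIdeal_iff [Finite V]
    (hI : I = Ideal.span ((fun a => monomial a 1) '' N)) {P : Ideal (MvPolynomial V K)} :
    P ∈ associatedPrimes (MvPolynomial V K) (MvPolynomial V K ⧸ I) ↔
      ∃ T : Finset V, P = variableIdeal K T ∧ ∃ a : V →₀ ℕ,
        (∀ v ∈ T, monomial (a + Finsupp.single v 1) 1 ∈ I) ∧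
        ∀ d : V →₀ ℕ, (∀ v ∈ T, d v = 0) → monomial (a + d) 1 ∉ I := by
  classical
  rw [mem_associatedPrimes_quotient_iff]
  constructor
  · rintro ⟨hP, hex⟩
    obtain ⟨f, hf, hmin⟩ := (measure fun f : MvPolynomial V K => f.support.card).wf.has_min
      {f | ∀ g, g ∈ P ↔ g * f ∈ I} hex
    have hf : ∀ g, g ∈ P ↔ g * f ∈ I := hf
    obtain ⟨m⟩ : Nonempty (MonomialOrder V) := by
      let : LinearOrder V := LinearOrder.lift' _ (Finite.equivFin V).injective
      exact ⟨MonomialOrder.lex⟩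
    have hlead : ∀ g ∈ P, g ≠ 0 → monomial (m.degree g) 1 ∈ P := fun g =>
      monomial_degree_mem_of_minimal_support hI m hf fun f' hf' => not_lt.1 (hmin f' hf')
    have := Fintype.ofFinite V
    set T : Finset V := {v | X v ∈ P} with hT
    have hPT : P = variableIdeal K T := by
      refine le_antisymm (fun g hg => mem_variableIdeal.2 fun a ha => ?_)
        (variableIdeal_le_iff.2 fun v hv => (Finset.mem_filter.1 hv).2)
      obtain ⟨v, hv, hav⟩ := exists_mem_support_of_mem_of_minimal_support m hlead hg a ha
      exact ⟨v, Finset.mem_filter.2 ⟨Finset.mem_univ v, hv⟩, hav⟩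
    refine ⟨T, hPT, ?_⟩
    by_contra! hcon
    have hsupp : ∀ a ∈ f.support, ∀ v ∈ T, monomial (a + Finsupp.single v 1) 1 ∈ I := by
      intro a ha v hv
      have := (hf (X v)).1 (Finset.mem_filter.1 hv).2
      rw [hI, mem_span_monomial_iff] at this
      rw [hI]
      refine this _ ?_
      rw [X, support_monomial_one_mul, add_comm]
      exact Finset.mem_map_of_mem _ ha
    -- If no single term of `f` worked, each term would be pushed into `I` by a monomial free of
    -- `T`. Their product would push all of `f` into `I`, hence lie in `P`, which is generated by
    -- the variables in `T`.
    choose! d hdT hd using fun a ha => hcon a (hsupp a ha)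
    have hmem : monomial (∑ a ∈ f.support, d a) (1 : K) ∈ P := by
      rw [hf, hI, mem_span_monomial_iff]
      intro b hb
      rw [support_monomial_one_mul, Finset.mem_map] at hb
      obtain ⟨a, ha, rfl⟩ := hb
      have hle : d a ≤ ∑ a ∈ f.support, d a :=
        Finset.single_le_sum (f := d) (fun _ _ => zero_le) ha
      have := hd a ha
      rw [hI, monomial_mem_span_monomial_iff] at this
      obtain ⟨n, hn, hna⟩ := this
      refine monomial_mem_span_monomial_iff.2 ⟨n, hn, hna.trans ?_⟩
      rw [addLeftEmbedding_apply, add_comm]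
      exact add_le_add_left hle a
    rw [hPT, monomial_mem_variableIdeal] at hmem
    obtain ⟨v, hv, hne⟩ := hmem
    rw [Finsupp.finsetSum_apply] at hne
    exact hne (Finset.sum_eq_zero fun a ha => hdT a ha v hv)
  · rintro ⟨T, rfl, a, haT, ha⟩
    refine ⟨inferInstance, monomial a 1, fun g => ⟨fun hg => ?_, fun hg => ?_⟩⟩
    · have : variableIdeal K T ≤ Submodule.colon I {monomial a (1 : K)} := by
        refine variableIdeal_le_iff.2 fun v hv => ?_
        rw [Submodule.mem_colon_singleton, smul_eq_mul, X, monomial_mul, one_mul, add_comm]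
        exact haT v hv
      simpa using this hg
    · rw [mem_variableIdeal]
      intro d hd
      by_contra! hdT
      refine ha d hdT ?_
      rw [hI, mem_span_monomial_iff] at hg
      rw [hI]
      refine hg _ ?_
      rw [mul_comm, support_monomial_one_mul]
      exact Finset.mem_map_of_mem _ hd

end MonomialIdeal

/-! ### Powers of the cover ideal as multicolouring problems. -/

section CoverIdeal

variable {V K : Type*} [Field K] {G : SimpleGraph V}

/-- The exponents of the generators of the `s`-th power of the cover ideal. -/
def coverExponents (G : SimpleGraph V) (s : ℕ) : Set (V →₀ ℕ) :=
  {a | ∃ w : Fin s → Finset V, (∀ i, G.IsVertexCover (w i : Set V)) ∧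
    a = ∑ i, ∑ v ∈ w i, Finsupp.single v 1}

theorem coverIdeal_pow_eq_span (s : ℕ) : coverIdeal K G ^ s =
    Ideal.span ((fun a => monomial a (1 : K)) '' coverExponents G s) := by
  have hX : ∀ w : Finset V, ∏ v ∈ w, (X v : MvPolynomial V K) =
      monomial (∑ v ∈ w, Finsupp.single v 1) 1 := fun w => by
    rw [monomial_sum_one]
    rfl
  rw [coverIdeal, Ideal.span, Submodule.span_pow]
  congr 1
  ext x
  rw [Set.mem_pow_iff_prod]
  constructor
  · rintro ⟨f, hf, rfl⟩
    choose w hw hfw using hf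
    refine ⟨_, ⟨w, hw, rfl⟩, ?_⟩
    simp only [hfw, hX, monomial_sum_one]
  · rintro ⟨_, ⟨w, hw, rfl⟩, rfl⟩
    refine ⟨fun i => ∏ v ∈ w i, X v, fun i => ⟨w i, hw i, rfl⟩, ?_⟩
    simp only [hX, monomial_sum_one]

theorem sum_indicator_apply [DecidableEq V] {s : ℕ} (w : Fin s → Finset V) (v : V) :
    (∑ i, ∑ u ∈ w i, Finsupp.single u 1 : V →₀ ℕ) v =
      (Finset.univ.filter fun i => v ∈ w i).card := by
  simp [Finsupp.finsetSum_apply, Finsupp.single_apply]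

/-- Colour `i` is given to the vertices outside the `i`-th cover. Truncated subtraction is intended:
an exponent of at least `s` imposes no demand. -/
theorem monomial_mem_coverIdeal_pow_iff [Finite V] {s : ℕ} {a : V →₀ ℕ} :
    monomial a (1 : K) ∈ coverIdeal K G ^ s ↔ G.Multicolorable s fun v => s - a v := by
  classical
  have := Fintype.ofFinite V
  rw [coverIdeal_pow_eq_span, monomial_mem_span_monomial_iff]
  constructor
  · rintro ⟨_, ⟨w, hw, rfl⟩, ha⟩
    refine ⟨fun v => Finset.univ.filter fun i => v ∉ w i, fun v => ?_, fun u v huv => ?_⟩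
    · have h1 := ha v
      rw [sum_indicator_apply] at h1
      have h2 := Finset.card_filter_add_card_filter_not (s := (Finset.univ : Finset (Fin s)))
        (fun i => v ∈ w i)
      rw [Finset.card_univ, Fintype.card_fin] at h2
      dsimp only
      omega
    · rw [Finset.disjoint_left]
      intro i hi hi'
      exact (hw i huv).elim (Finset.mem_filter.1 hi).2 (Finset.mem_filter.1 hi').2
  · rintro ⟨f, hf, hd⟩
    refine ⟨_, ⟨fun i => Finset.univ.filter fun v => i ∉ f v, fun i u v huv => ?_, rfl⟩, fun v => ?_⟩
    · simp only [Finset.coe_filter, Finset.mem_univ, true_and, Set.mem_ofPred_eq]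
      by_contra! h
      exact Finset.disjoint_left.1 (hd u v huv) h.1 h.2
    · rw [sum_indicator_apply]
      have h1 : s - a v ≤ (f v).card := hf v
      have h2 := Finset.card_filter_add_card_filter_not (s := (Finset.univ : Finset (Fin s)))
        (fun i => i ∈ f v)
      rw [Finset.card_univ, Fintype.card_fin, Finset.filter_univ_mem] at h2
      simp only [Finset.mem_filter, Finset.mem_univ, true_and]
      omega

/-- The weight function `b` with support `T` is critical if it has no multicolouring with `s`
colours, but the weight functions obtained from it by decreasing a value by one have one. -/
structure SimpleGraph.IsCriticalWeight [DecidableEq V] (G : SimpleGraph V) (s : ℕ) (T : Finset V)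
    (b : V → ℕ) : Prop where
  le : ∀ v, b v ≤ s
  ne_zero_iff : ∀ v, b v ≠ 0 ↔ v ∈ T
  not_multicolorable : ¬ G.Multicolorable s b
  multicolorable_update : ∀ v ∈ T, G.Multicolorable s (Function.update b v (b v - 1))

/-- The associated primes of the powers of the cover ideal in terms of critical weights. -/
theorem mem_associatedPrimes_coverIdeal_pow_iff [Finite V] [DecidableEq V] {s : ℕ}
    {P : Ideal (MvPolynomial V K)} :
    P ∈ associatedPrimes (MvPolynomial V K) (MvPolynomial V K ⧸ coverIdeal K G ^ s) ↔
      ∃ T : Finset V, P = variableIdeal K T ∧ ∃ b, G.IsCriticalWeight s T b := by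
  rw [mem_associatedPrimes_monomialIdeal_iff (coverIdeal_pow_eq_span s)]
  refine exists_congr fun T => and_congr_right fun _ => ?_
  simp only [monomial_mem_coverIdeal_pow_iff]
  constructor
  · rintro ⟨a, haT, ha⟩
    -- Exponents off `T` may be raised by `d` at will; raising them by `s` removes all demand there.
    set b : V → ℕ := fun v => if v ∈ T then s - a v else 0 with hb
    have hbT : ∀ v ∈ T, b v = s - a v := fun v hv => if_pos hv
    have hbT' : ∀ v ∉ T, b v = 0 := fun v hv => if_neg hv
    have hnot : ¬ G.Multicolorable s b := fun h => by
      refine ha (Finsupp.equivFunOnFinite.symm fun v => if v ∈ T then 0 else s)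
        (fun v hv => by simp [hv]) (h.mono fun v => ?_)
      by_cases hv : v ∈ T <;> simp [hb, hv]
    refine ⟨b, fun v => ?_, fun v => ⟨fun hv => ?_, fun hv h0 => hnot ?_⟩, hnot, fun v hv => ?_⟩
    · by_cases hv : v ∈ T
      · rw [hbT v hv]; omega
      · rw [hbT' v hv]; omega
    · by_contra h
      exact hv (hbT' v h)
    · refine (haT v hv).mono fun u => ?_
      by_cases huv : u = v
      · subst huv; omega
      · by_cases hu : u ∈ T
        · simp [hbT u hu, Ne.symm huv]
        · simp [hbT' u hu]
    · refine (haT v hv).mono fun u => ?_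
      by_cases huv : u = v
      · subst huv
        simp [hbT u hv, Nat.sub_sub]
      · rw [Function.update_of_ne huv]
        by_cases hu : u ∈ T
        · simp [hbT u hu, Ne.symm huv]
        · simp [hbT' u hu]
  · rintro ⟨b, hle, hne, hnot, hup⟩
    refine ⟨Finsupp.equivFunOnFinite.symm fun v => s - b v, fun v hv => ?_, fun d hd h => hnot ?_⟩
    · refine (hup v hv).mono fun u => ?_
      have := hle u
      by_cases huv : u = v
      · subst huv
        simp; omega
      · simp [huv]; omega
    · refine h.mono fun v => ?_
      have := hle v
      by_cases hv : v ∈ T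
      · simp [hd v hv]; omega
      · rw [not_not.1 (mt (hne v).1 hv)]
        exact Nat.zero_le _

end CoverIdeal

/-! ### Critical weights, cliques and minimal imperfect subgraphs. -/

namespace SimpleGraph

variable {V : Type*} {G : SimpleGraph V}

/-- The subgraph of `G` induced by `U` can be coloured with as many colours as its clique number. -/
def CliqueColorable (G : SimpleGraph V) (U : Set V) : Prop :=
  ∀ s, (∀ T : Finset V, G.IsClique (T : Set V) → (T : Set V) ⊆ U → T.card ≤ s) →
    (G.induce U).Colorable s

/-- Only `χ ≤ ω` has content, since `ω ≤ χ` always holds. -/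
theorem isPerfectGraph_iff_forall_cliqueColorable [Finite V] :
    IsPerfectGraph G ↔ ∀ U, G.CliqueColorable U := by
  have key : ∀ U s, (∀ T : Finset V, G.IsClique (T : Set V) → (T : Set V) ⊆ U → T.card ≤ s) ↔
      (G.induce U).cliqueNum ≤ s := by
    classical
    intro U s
    constructor
    · intro h
      obtain ⟨t, ht⟩ := (G.induce U).exists_isNClique_cliqueNum
      rw [isNClique_induce_iff] at ht
      rw [← ht.card_eq]
      refine h _ ht.isClique fun x hx => ?_
      obtain ⟨y, -, rfl⟩ := Finset.mem_map.1 hx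
      exact y.2
    · intro h T hT hTU
      refine le_trans ?_ h
      have hc : (G.induce U).IsClique (T.subtype (· ∈ U) : Set U) := fun x hx y hy hxy =>
        hT (Finset.mem_subtype.1 hx) (Finset.mem_subtype.1 hy) (Subtype.coe_injective.ne hxy)
      rw [← Finset.filter_true_of_mem (s := T) (p := (· ∈ U)) fun x hx => hTU hx,
        ← Finset.card_subtype]
      exact hc.card_le_cliqueNum
  refine forall_congr' fun U => ?_
  rw [CliqueColorable]
  simp only [key]
  constructor
  · intro h s hs
    rw [← chromaticNumber_le_iff_colorable, h]
    exact_mod_cast hs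
  · intro h
    refine le_antisymm (chromaticNumber_le_iff_colorable.2 (h _ le_rfl)) ?_
    obtain ⟨t, ht⟩ := (G.induce U).exists_isNClique_cliqueNum
    rw [← ht.card_eq]
    exact ht.isClique.card_le_chromaticNumber

/-- A graph which is not perfect has a minimal imperfect induced subgraph `G[W]`, with a number of
colours `s` that is at least its clique number and does not suffice to colour it. -/
theorem exists_minimal_imperfect [Finite V] (h : ¬ IsPerfectGraph G) : ∃ (W : Finset V) (s : ℕ),
    1 ≤ s ∧ (∀ T : Finset V, G.IsClique (T : Set V) → T ⊆ W → T.card ≤ s) ∧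
    ¬ (G.induce (W : Set V)).Colorable s ∧ ∀ U ⊂ (W : Set V), G.CliqueColorable U := by
  classical
  rw [isPerfectGraph_iff_forall_cliqueColorable] at h
  push Not at h
  obtain ⟨W, hW, hmin⟩ := (wellFounded_lt (α := Set V)).has_min {U | ¬ G.CliqueColorable U} h
  obtain ⟨W, rfl⟩ := W.toFinite.exists_finset_coe
  have hW' : ¬ G.CliqueColorable (W : Set V) := hW
  rw [CliqueColorable] at hW'
  push Not at hW'
  obtain ⟨s, hs, hns⟩ := hW'
  refine ⟨W, s, ?_, fun T hT hTW => hs T hT (Finset.coe_subset.2 hTW), hns,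
    fun U hU => not_not.1 fun hc => hmin U hc hU⟩
  obtain ⟨v, hv⟩ : W.Nonempty := by
    by_contra hne
    rw [Finset.not_nonempty_iff_eq_empty] at hne
    subst hne
    exact hns ⟨Coloring.mk (fun v => absurd v.2 (by simp)) fun {v} => absurd v.2 (by simp)⟩
  simpa using hs {v} (by simp) (by simpa using hv)

theorem colorable_induce_card (W : Finset V) : (G.induce (W : Set V)).Colorable W.card := by
  simpa using (G.induce (W : Set V)).colorable_of_fintype

/-- Two nonadjacent vertices can be given the same colour. -/
theorem colorable_induce_card_of_not_adj [DecidableEq V] {W : Finset V} {x v : V}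
    (hx : x ∈ W) (hxv : ¬ G.Adj v x) : (G.induce (insert v W : Set V)).Colorable W.card := by
  have h : ∀ u : (insert v W : Set V), (if (u : V) = v then x else u) ∈ W := fun u => by
    split_ifs with hu
    · exact hx
    · exact Finset.mem_coe.1 (u.2.resolve_left hu)
  have C : (G.induce (insert v W : Set V)).Coloring W :=
    Coloring.mk (fun u => ⟨_, h u⟩) fun {a b} hab he => by
      have hadj : G.Adj a b := hab
      have he := congrArg Subtype.val he
      dsimp only at he
      split_ifs at he with ha hb hb
      · exact hadj.ne (ha.trans hb.symm)
      · exact hxv (ha ▸ he ▸ hadj)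
      · exact hxv (hb ▸ he ▸ hadj.symm)
      · exact hadj.ne he
  simpa using C.colorable

variable [DecidableEq V]

/-- By replication some clique `S` weighs more than `s`. Lowering any vertex of `T` must repair
this, so `T ⊆ S` and the total weight is `s + 1`. -/
theorem IsCriticalWeight.isClique [Finite V] {s : ℕ} {T : Finset V} {b : V → ℕ}
    (h : G.IsCriticalWeight s T b) (hT : ∀ U ⊆ (T : Set V), G.CliqueColorable U) :
    G.IsClique (T : Set V) ∧ 1 < T.card ∧ T.card ≤ s + 1 := by
  have := Fintype.ofFinite V
  obtain ⟨hle, hne, hnot, hup⟩ := h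
  obtain ⟨S, hS, hSs⟩ : ∃ S : Finset V, G.IsClique (S : Set V) ∧ s < ∑ v ∈ S, b v := by
    by_contra! hcon
    exact hnot (multicolorable_of_sum_isClique_le hT (fun v hv => (hne v).1 hv) hcon)
  have hTS : T ⊆ S := fun v hv => by
    by_contra hvS
    have := (hup v hv).sum_le_of_isClique hS
    rw [Finset.sum_update_of_notMem hvS] at this
    omega
  have hST : ∑ v ∈ T, b v = ∑ v ∈ S, b v :=
    Finset.sum_subset hTS fun v _ hv => not_not.1 (mt (hne v).1 hv)
  have hTc : G.IsClique (T : Set V) := hS.subset hTS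
  have hTne : T.Nonempty := by
    rw [Finset.nonempty_iff_ne_empty]
    rintro rfl
    simp at hST
    omega
  obtain ⟨v, hv⟩ := hTne
  have hle' := (hup v hv).sum_le_of_isClique hTc
  rw [Finset.sum_update_of_mem hv, ← Finset.erase_eq] at hle'
  have hsum := Finset.add_sum_erase T b hv
  have hcard : T.card ≤ ∑ v ∈ T, b v := by
    rw [Finset.card_eq_sum_ones]
    exact Finset.sum_le_sum fun v hv => Nat.one_le_iff_ne_zero.2 ((hne v).2 hv)
  refine ⟨hTc, ?_, by omega⟩
  -- A single vertex would have to carry weight above `s`, which the field `le` forbids.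
  by_contra! hcon
  obtain rfl : T = {v} := Finset.eq_singleton_iff_unique_mem.2
    ⟨hv, fun u hu => Finset.card_le_one.1 hcon u hu v hv⟩
  have := hle v
  rw [Finset.sum_singleton] at hST
  omega

theorem exists_isCriticalWeight_of_isClique [Finite V] {s : ℕ} {T : Finset V}
    (hT : ∀ U ⊆ (T : Set V), G.CliqueColorable U)
    (hTc : G.IsClique (T : Set V)) (h1 : 1 < T.card) (hs : T.card ≤ s + 1) :
    ∃ b, G.IsCriticalWeight s T b := by
  have := Fintype.ofFinite V
  obtain ⟨t, ht⟩ : T.Nonempty := Finset.card_pos.1 (by omega)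
  -- The value at `t` makes the total `s + 1`; the bounds on `T.card` place it between `1` and `s`.
  set b : V → ℕ := fun v => if v = t then s + 2 - T.card else if v ∈ T then 1 else 0 with hb
  have hbt : b t = s + 2 - T.card := if_pos rfl
  have hbT : ∀ v ∈ T.erase t, b v = 1 := fun v hv => by
    rw [Finset.mem_erase] at hv
    simp [hb, hv.1, hv.2]
  have hbT' : ∀ v ∉ T, b v = 0 := fun v hv => by
    have : v ≠ t := by rintro rfl; exact hv ht
    simp [hb, hv, this]
  have hbpos : ∀ v ∈ T, 1 ≤ b v := fun v hv => by
    by_cases h : v = t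
    · subst h; omega
    · exact (hbT v (Finset.mem_erase.2 ⟨h, hv⟩)).ge
  have hsum : ∑ v ∈ T, b v = s + 1 := by
    rw [← Finset.add_sum_erase T b ht, Finset.sum_congr rfl hbT, ← Finset.card_eq_sum_ones, hbt,
      Finset.card_erase_of_mem ht]
    omega
  refine ⟨b, fun v => ?_, fun v => ⟨fun hv => ?_, fun hv => ?_⟩, fun h => ?_, fun v hv => ?_⟩
  · by_cases h : v ∈ T.erase t
    · rw [hbT v h]; omega
    · by_cases h' : v ∈ T
      · obtain rfl : v = t := by simpa [h'] using h
        omega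
      · rw [hbT' v h']; omega
  · by_contra h
    exact hv (hbT' v h)
  · have := hbpos v hv
    omega
  · have := h.sum_le_of_isClique hTc
    omega
  · have hzero : ∀ u ∉ T, Function.update b v (b v - 1) u = 0 := fun u hu => by
      rw [Function.update_of_ne (by rintro rfl; exact hu hv), hbT' u hu]
    refine multicolorable_of_sum_isClique_le hT (fun u hu => ?_) fun S _ => ?_
    · by_contra h
      exact hu (hzero u h)
    · refine (Finset.sum_le_sum_of_subset S.subset_univ).trans ?_
      rw [← Finset.sum_subset T.subset_univ fun u _ hu => hzero u hu,
        Finset.sum_update_of_mem hv, ← Finset.erase_eq]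
      have := Finset.add_sum_erase T b hv
      have := hbpos v hv
      omega

/-- A minimal imperfect induced subgraph has a critical weight. -/
theorem exists_isCriticalWeight_of_minimal_imperfect {s : ℕ} {W : Finset V} (hs : 1 ≤ s)
    (hclique : ∀ T : Finset V, G.IsClique (T : Set V) → T ⊆ W → T.card ≤ s)
    (hW : ¬ (G.induce (W : Set V)).Colorable s) (hmin : ∀ U ⊂ (W : Set V), G.CliqueColorable U) :
    ∃ b, G.IsCriticalWeight s W b := by
  -- Lowering the indicator of `W` at `v` leaves that of `W.erase v`, which is colourable by
  -- minimality.
  refine ⟨fun v => if v ∈ W then 1 else 0, fun v => ?_, fun v => by simp, fun h => ?_,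
    fun v hv => ?_⟩
  · split_ifs <;> omega
  · exact hW (h.colorable_induce fun v hv => by simpa using hv)
  · refine multicolorable_of_colorable_induce (U := (W.erase v : Finset V))
      (hmin _ (by exact_mod_cast Finset.erase_ssubset hv) s fun T hT hTU =>
        hclique T hT ((Finset.coe_subset.1 hTU).trans (Finset.erase_subset v W))) (fun u => ?_)
        fun u hu => ?_
    · by_cases huv : u = v
      · subst huv; simp [hv]
      · rw [Function.update_of_ne huv]
        split_ifs <;> omega
    · by_cases huv : u = v
      · subst huv; simp [hv] at hu
      · rw [Function.update_of_ne huv] at hu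
        simpa [huv] using hu

end SimpleGraph

/-! ### The equivalences. -/

section Main

variable {V K : Type*} [Field K] {G : SimpleGraph V}

theorem coverIdeal_le_variableIdeal_of_adj [DecidableEq V] {u v : V} (huv : G.Adj u v) :
    coverIdeal K G ≤ variableIdeal K {u, v} := by
  refine Ideal.span_le.2 ?_
  rintro _ ⟨w, hw, rfl⟩
  rcases hw huv with h | h
  · exact Ideal.mem_of_dvd _ (Finset.dvd_prod_of_mem _ (Finset.mem_coe.1 h))
      (X_mem_variableIdeal.2 (by simp))
  · exact Ideal.mem_of_dvd _ (Finset.dvd_prod_of_mem _ (Finset.mem_coe.1 h))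
      (X_mem_variableIdeal.2 (by simp))

/-- All vertices except `v` form a cover, as there are no loops. So the prime `Q` contains a
variable other than `X v`, and inside the ideal of the pair only `X u` is left. -/
theorem X_mem_of_coverIdeal_le [Finite V] [DecidableEq V] {u v : V} {Q : Ideal (MvPolynomial V K)}
    [Q.IsPrime] (hJ : coverIdeal K G ≤ Q) (hQ : Q ≤ variableIdeal K {u, v}) : X u ∈ Q := by
  have := Fintype.ofFinite V
  have hmem : ∏ w ∈ Finset.univ.erase v, (X w : MvPolynomial V K) ∈ Q := by
    refine hJ (Ideal.subset_span ⟨_, fun x y hxy => ?_, rfl⟩)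
    by_contra! h
    simp only [Finset.coe_erase, Finset.coe_univ, Set.mem_sdiff, Set.mem_univ, true_and,
      Set.mem_singleton_iff, not_not] at h
    exact hxy.ne (h.1.trans h.2.symm)
  obtain ⟨w, hw, hwQ⟩ := Ideal.IsPrime.prod_mem_iff.1 hmem
  have hw' := X_mem_variableIdeal.1 (hQ hwQ)
  have hwv := (Finset.mem_erase.1 hw).1
  obtain rfl : w = u := by simpa [hwv] using hw'
  exact hwQ

theorem variableIdeal_pair_mem_minimalPrimes [Finite V] [DecidableEq V] {u v : V} {s : ℕ}
    (h : coverIdeal K G ^ s ≤ variableIdeal K {u, v}) :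
    variableIdeal K {u, v} ∈ (coverIdeal K G ^ s).minimalPrimes := by
  refine ⟨⟨inferInstance, h⟩, fun Q hQ hQle => ?_⟩
  have := hQ.1
  have hJ : coverIdeal K G ≤ Q := Ideal.IsPrime.le_of_pow_le hQ.2
  refine variableIdeal_le_iff.2 fun w hw => ?_
  rcases Finset.mem_insert.1 hw with rfl | hw
  · exact X_mem_of_coverIdeal_le hJ hQle
  · rw [Finset.mem_singleton.1 hw]
    exact X_mem_of_coverIdeal_le hJ (hQle.trans_eq (by rw [Finset.pair_comm]))

theorem IsPerfectGraph.associatedPrimes_eq [Finite V] (hG : IsPerfectGraph G) (s : ℕ) :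
    associatedPrimes (MvPolynomial V K) (MvPolynomial V K ⧸ coverIdeal K G ^ s) =
      {P | ∃ T : Finset V, G.IsClique (T : Set V) ∧ 1 < T.card ∧ T.card ≤ s + 1 ∧
        P = variableIdeal K T} := by
  classical
  have hG := SimpleGraph.isPerfectGraph_iff_forall_cliqueColorable.1 hG
  ext P
  rw [mem_associatedPrimes_coverIdeal_pow_iff]
  constructor
  · rintro ⟨T, rfl, b, hb⟩
    obtain ⟨h1, h2, h3⟩ := hb.isClique fun U _ => hG U
    exact ⟨T, h1, h2, h3, rfl⟩
  · rintro ⟨T, h1, h2, h3, rfl⟩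
    exact ⟨T, rfl, SimpleGraph.exists_isCriticalWeight_of_isClique (fun U _ => hG U) h1 h2 h3⟩

theorem IsPerfectGraph.hasSaturatedChainProperty [Finite V] (hG : IsPerfectGraph G) (s : ℕ) :
    HasSaturatedChainProperty (coverIdeal K G ^ s) := by
  classical
  intro P hP hPmin
  have hle := le_of_mem_associatedPrimes_quotient hP
  rw [hG.associatedPrimes_eq] at hP ⊢
  obtain ⟨T, hT, h1, hs, rfl⟩ := hP
  -- Two-element cliques give minimal primes, so `T` has at least three vertices and stays
  -- admissible after losing one.
  have h2 : T.card ≠ 2 := fun h2 => by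
    obtain ⟨u, v, -, rfl⟩ := Finset.card_eq_two.1 h2
    exact hPmin (variableIdeal_pair_mem_minimalPrimes hle)
  obtain ⟨t, ht⟩ : T.Nonempty := Finset.card_pos.1 (by omega)
  have hcard := Finset.card_erase_of_mem ht
  refine ⟨_, ⟨T.erase t, hT.subset (Finset.coe_subset.2 (T.erase_subset t)), by omega, by omega, rfl⟩,
    variableIdeal_lt_variableIdeal_iff.2 (Finset.erase_ssubset ht), ?_⟩
  rw [height_variableIdeal, height_variableIdeal]
  exact_mod_cast Finset.card_erase_add_one ht

theorem isPerfectGraph_of_associatedPrimes_eq [Finite V]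
    (h : ∀ s : ℕ, 1 ≤ s → (s : ℕ∞) < G.chromaticNumber →
      associatedPrimes (MvPolynomial V K) (MvPolynomial V K ⧸ coverIdeal K G ^ s) =
        {P | ∃ T : Finset V, G.IsClique (T : Set V) ∧ 1 < T.card ∧ T.card ≤ s + 1 ∧
          P = variableIdeal K T}) : IsPerfectGraph G := by
  classical
  by_contra hG
  obtain ⟨W, s, hs, hclique, hW, hmin⟩ := SimpleGraph.exists_minimal_imperfect hG
  have hχ : (s : ℕ∞) < G.chromaticNumber := by
    rw [← not_le, SimpleGraph.chromaticNumber_le_iff_colorable]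
    exact fun hc => hW (hc.of_hom (SimpleGraph.Embedding.induce (W : Set V)).toHom)
  have hP : variableIdeal K W ∈
      associatedPrimes (MvPolynomial V K) (MvPolynomial V K ⧸ coverIdeal K G ^ s) :=
    mem_associatedPrimes_coverIdeal_pow_iff.2
      ⟨W, rfl, SimpleGraph.exists_isCriticalWeight_of_minimal_imperfect hs hclique hW hmin⟩
  rw [h s hs hχ] at hP
  obtain ⟨T, hT, -, -, hWT⟩ := hP
  obtain rfl := variableIdeal_injective hWT
  exact hW ((SimpleGraph.colorable_induce_card W).mono (hclique W hT subset_rfl))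

theorem isPerfectGraph_of_hasSaturatedChainProperty [Finite V]
    (h : ∀ s : ℕ, 1 ≤ s → HasSaturatedChainProperty (coverIdeal K G ^ s)) : IsPerfectGraph G := by
  classical
  by_contra hG
  obtain ⟨W, s, hs, hclique, hW, hmin⟩ := SimpleGraph.exists_minimal_imperfect hG
  have hWc : ¬ G.IsClique (W : Set V) := fun hc =>
    hW ((SimpleGraph.colorable_induce_card W).mono (hclique W hc subset_rfl))
  have hnotmin : variableIdeal K W ∉ (coverIdeal K G ^ s).minimalPrimes := fun hmem => by
    -- An edgeless `G[W]` would need only one colour. The prime of an edge in `W` contains `J^s`, so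
    -- minimality would force `W` to be that edge, a clique.
    obtain ⟨u, hu, v, hv, huv⟩ : ∃ u ∈ W, ∃ v ∈ W, G.Adj u v := by
      by_contra! hcon
      exact hW ⟨SimpleGraph.Coloring.mk (fun _ => ⟨0, hs⟩)
        fun {a b} hab => absurd hab (hcon a a.2 b b.2)⟩
    have hle := variableIdeal_le_variableIdeal_iff.1 (hmem.2 ⟨inferInstance,
      (Ideal.pow_le_self (by omega)).trans (coverIdeal_le_variableIdeal_of_adj huv)⟩
      (variableIdeal_le_variableIdeal_iff.2
        (Finset.insert_subset hu (Finset.singleton_subset_iff.2 hv))))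
    refine hWc (SimpleGraph.IsClique.subset (s := {u, v}) (fun x hx => by simpa using hle hx) ?_)
    rw [SimpleGraph.isClique_pair]
    exact fun _ => huv
  obtain ⟨Q, hQ, hQW, hheight⟩ := h s hs (variableIdeal K W)
    (mem_associatedPrimes_coverIdeal_pow_iff.2
      ⟨W, rfl, SimpleGraph.exists_isCriticalWeight_of_minimal_imperfect hs hclique hW hmin⟩) hnotmin
  obtain ⟨T, rfl, b, hb⟩ := mem_associatedPrimes_coverIdeal_pow_iff.1 hQ
  rw [variableIdeal_lt_variableIdeal_iff] at hQW
  rw [height_variableIdeal, height_variableIdeal] at hheight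
  have hcard : T.card + 1 = W.card := by exact_mod_cast hheight
  -- Proper subsets of `W` are clique-colourable, so replication applies to the support `T`.
  have hTc := (hb.isClique fun U hU => hmin U (hU.trans_ssubset (Finset.coe_ssubset.2 hQW))).1
  have hTs := hclique T hTc hQW.subset
  obtain ⟨v, hv⟩ : ∃ v, W \ T = {v} := by
    rw [← Finset.card_eq_one, Finset.card_sdiff_of_subset hQW.subset]
    omega
  obtain rfl : W = insert v T := by
    rw [Finset.insert_eq, ← hv, Finset.sdiff_union_of_subset hQW.subset]
  rw [Finset.coe_insert] at hWc hW
  refine hWc (hTc.insert fun x hx _ => ?_)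
  by_contra hadj
  exact hW ((SimpleGraph.colorable_induce_card_of_not_adj hx hadj).mono hTs)

end Main

theorem mainTheorem1 {V : Type*} [Finite V] (K : Type*) [Field K] (G : SimpleGraph V) :
    List.TFAE [
      IsPerfectGraph G,
      ∀ s : ℕ, 1 ≤ s → (s : ℕ∞) < G.chromaticNumber →
        associatedPrimes (MvPolynomial V K) (MvPolynomial V K ⧸ coverIdeal K G ^ s) =
          {P | ∃ T : Finset V, G.IsClique (T : Set V) ∧ 1 < T.card ∧ T.card ≤ s + 1 ∧
            P = variableIdeal K T},
      ∀ s : ℕ, 1 ≤ s → HasSaturatedChainProperty (coverIdeal K G ^ s)] := by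
  tfae_have 1 → 2 := fun hG s _ _ => hG.associatedPrimes_eq s
  tfae_have 2 → 1 := isPerfectGraph_of_associatedPrimes_eq
  tfae_have 1 → 3 := fun hG s _ => hG.hasSaturatedChainProperty s
  tfae_have 3 → 1 := isPerfectGraph_of_hasSaturatedChainProperty
  tfae_finish
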